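/- **Proposition.** Let $K$ be an algebraically closed field of characteristic $p\neq 0,2,3$, and let $E: y^2=x^3+Ax+B$ be an ordinary elliptic curve over $K$, with point at infinity $\mathcal O$. Let $\tilde E$ be its canonical lift, given by the same equation over the dual numbers $K[\varepsilon]$, $\varepsilon^2=0$, and let $\mathcal O_k=(k\varepsilon:1:0)\in\tilde E(K[\varepsilon])$ for $k\in K$. An *addition chain* for $n$ is a set $S\subset\{1,\dots,n\}$ containing $n$ in which every element $>1$ is a sum of two elements of $S$. An *addition chain decomposition* $C$ of $n$ is a sequence of steps $(i+j\mapsto i,j)$ with $i,j,i+j\in S$, for some addition chain $S$, that decomposes $n$ into a sum of $n$ ones (steps are counted with repetition). Let $P\in E[p]$, let $T\in E(K)$ be a point of order two, let $\tau$ be translation by $-T$, and let $R\in E[p]$ with $R\notin E[2]$. Let $\ell_{i,j}=y-m_{i,j}x-b_{i,j}$ define the (chord or tangent) line through $iP$ and $jP$ when it is not vertical, let $v_i=x-x(iP)$, and put $$h_{i,j}=\frac{\ell_{i,j}}{v_{i+j}}\circ\tau\ \text{ if } i+j\ne p,\qquad h_{i,j}=v_i\circ\tau\ \text{ if } i+j=p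 .$$ For an addition chain decomposition $C_0$ of $p$ define $$e(P,\mathcal O_k)=\prod_{C_0}\frac{h_{i,j}(\mathcal O_k+R)}{h_{i,j}(R)}\in K[\varepsilon]\quad\text{if } P\ne\mathcal O \text{ and } k\neq 0,$$ and $e(P,\mathcal O_k)=1$ if $P=\mathcal O$ or $k=0$. Then: 1. if $P\neq\mathcal O$, all denominators occurring in the values $h_{i,j}(R)$ and $h_{i,j}(\mathcal O_k+R)$, and the values $h_{i,j}(R)$ themselves, are units of $K[\varepsilon]$, for every step of $C_0$; 2. for every addition chain decomposition $C$ of $p$ (whether or not $C = C_0$) and every $k\in K$, $$e(P,\mathcal O_k)=1-\Big[\sum_{C} m_{i,j}\Big]k\,\varepsilon ,$$ where $m_{i,j}$ is the slope of the line through $iP$ and $jP$, the (vertical) step with $i+j=p$ contributes $0$ to the sum, and the sum is read as $0$ if $P=\mathcal O$. -/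

import Mathlib

open scoped DualNumber

namespace EllDual

noncomputable section

/-- The short Weierstrass curve `y² = x³ + a x + b` over a commutative ring. Over `K[ε]`, with
constant coefficients, it is the canonical lift of the curve over `K`. -/
def shortW {F : Type*} [CommRing F] (a b : F) : WeierstrassCurve F :=
  ⟨0, 0, 0, a, b⟩

/-- The points of `E : y² = x³ + A x + B` over `K`, with the point at infinity `0`. -/
abbrev Pt {K : Type*} [Field K] (A B : K) : Type _ :=
  (shortW A B).toAffine.Point

/-! ### Addition chain decompositions -/

/-- `S` is an addition chain for `n`: a set of integers in `{1, …, n}` containing `n`, each of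
whose elements greater than `1` is the sum of two elements of `S`. -/
def IsAdditionChain (S : Finset ℕ) (n : ℕ) : Prop :=
  S ⊆ Finset.Icc 1 n ∧ n ∈ S ∧ ∀ k ∈ S, 1 < k → ∃ i ∈ S, ∃ j ∈ S, i + j = k

/-- `Decomposes S M C`: the sequence `C` of steps `(i + j ↦ i, j)`, recorded as the pairs `(i, j)`,
with `i`, `j` and `i + j` in `S`, rewrites the formal sum `M` into a formal sum of ones. -/
inductive Decomposes (S : Finset ℕ) : Multiset ℕ → List (ℕ × ℕ) → Prop
  | nil (n : ℕ) : Decomposes S (Multiset.replicate n 1) []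
  | cons (i j : ℕ) (M : Multiset ℕ) (C : List (ℕ × ℕ)) (hi : i ∈ S) (hj : j ∈ S)
      (hij : i + j ∈ S) (h : Decomposes S (i ::ₘ j ::ₘ M) C) :
      Decomposes S ((i + j) ::ₘ M) ((i, j) :: C)

/-- `C` is an addition chain decomposition of `n` with respect to the addition chain `S`. -/
def IsChainDecomposition (S : Finset ℕ) (n : ℕ) (C : List (ℕ × ℕ)) : Prop :=
  IsAdditionChain S n ∧ Decomposes S {n} C

/-! ### Coordinates and slopes over `K` -/

section Field

variable {K : Type*} [Field K] {A B : K}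

/-- The `x`-coordinate of an affine point (junk value `0` at infinity). -/
def xOf : Pt A B → K
  | .zero => 0
  | .some x _ _ => x

/-- The `y`-coordinate of an affine point (junk value `0` at infinity). -/
def yOf : Pt A B → K
  | .zero => 0
  | .some _ y _ => y

/-- The slope of the line through two affine points: the chord, or the tangent line if the points
are equal. The value is `0` if the line is vertical or one of the points is at infinity. -/
def slopeOf [DecidableEq K] : Pt A B → Pt A B → K
  | .some x₁ y₁ _, .some x₂ y₂ _ => (shortW A B).toAffine.slope x₁ x₂ y₁ y₂
  | _, _ => 0

/-! ### Points of the canonical lift over `K[ε]`, in homogeneous coordinates -/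

/-- A point of `E(K)`, as a point of the canonical lift. -/
def toDual : Pt A B → Fin 3 → K[ε]
  | .zero => ![0, 1, 0]
  | .some x y _ => ![TrivSqZeroExt.inl x, TrivSqZeroExt.inl y, 1]

/-- The point at infinity `𝒪_k = (kε : 1 : 0)`. -/
def infPt (k : K) : Fin 3 → K[ε] :=
  ![k • ε, 1, 0]

variable (A B) in
/-- The addition law of the canonical lift `y² = x³ + A x + B` over `K[ε]`, for two points
that do not have the same reduction in `E(K)` (on such pairs the bihomogeneous formula
`addXYZ` yields a coordinate triple with a unit entry; it is used only for such pairs). -/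
def addDual (Q₁ Q₂ : Fin 3 → K[ε]) : Fin 3 → K[ε] :=
  (shortW (TrivSqZeroExt.inl A : K[ε]) (TrivSqZeroExt.inl B)).toProjective.addXYZ Q₁ Q₂

/-- The function `x = X / Z` on points over `K[ε]` whose `Z`-coordinate is a unit. -/
def xDual (Q : Fin 3 → K[ε]) : K[ε] :=
  Q 0 * (Q 2)⁻¹

/-- The function `y = Y / Z` on points over `K[ε]` whose `Z`-coordinate is a unit. -/
def yDual (Q : Fin 3 → K[ε]) : K[ε] :=
  Q 1 * (Q 2)⁻¹

/-- The function `v_U = x - x(U)` defining the vertical line through `U`, at a point over `K[ε]`. -/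
def vertEval (U : Pt A B) (Q : Fin 3 → K[ε]) : K[ε] :=
  xDual Q - TrivSqZeroExt.inl (xOf U)

variable [DecidableEq K]

/-- The function `ℓ_{U,V} = y - y(U) - m (x - x(U))` defining the non-vertical line of slope `m`
through `U` and `V`, at a point over `K[ε]`. -/
def lineEval (U V : Pt A B) (Q : Fin 3 → K[ε]) : K[ε] :=
  yDual Q - TrivSqZeroExt.inl (yOf U)
    - TrivSqZeroExt.inl (slopeOf U V) * (xDual Q - TrivSqZeroExt.inl (xOf U))

/-! ### The pairing -/

/-- The translation `τ` by `-T`. -/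
def transl (T : Pt A B) (Q : Fin 3 → K[ε]) : Fin 3 → K[ε] :=
  addDual A B Q (toDual (-T))

/-- The value at `Q` of the function `h_{i,j}`, which is `(ℓ_{iP,jP} / v_{(i+j)P}) ∘ τ` if
`i + j ≠ p` and `v_{iP} ∘ τ` if `i + j = p`. -/
def hEval (p : ℕ) (T P : Pt A B) (s : ℕ × ℕ) (Q : Fin 3 → K[ε]) : K[ε] :=
  if s.1 + s.2 = p then vertEval (s.1 • P) (transl T Q)
  else lineEval (s.1 • P) (s.2 • P) (transl T Q) * (vertEval ((s.1 + s.2) • P) (transl T Q))⁻¹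

/-- All denominators that occur in the evaluation of `h_{i,j}` at `Q` are units of `K[ε]`. -/
def hDefined (p : ℕ) (T P : Pt A B) (s : ℕ × ℕ) (Q : Fin 3 → K[ε]) : Prop :=
  IsUnit (transl T Q 2) ∧
    (s.1 + s.2 ≠ p → IsUnit (vertEval ((s.1 + s.2) • P) (transl T Q)))

open Classical in
/-- The pairing `e(P, 𝒪)` of `P ∈ E[p]` with a point at infinity `𝒪` of the canonical lift,
computed with the decomposition `C`, the evaluation point `R` and the translation point `T`. -/
def pairing (p : ℕ) (T R : Pt A B) (C : List (ℕ × ℕ)) (P : Pt A B) (O : Fin 3 → K[ε]) : K[ε] :=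
  if P = 0 ∨ O = infPt 0 then 1
  else (C.map fun s =>
    hEval p T P s (addDual A B O (toDual R)) * (hEval p T P s (toDual R))⁻¹).prod

end Field

end

end EllDual

open EllDual

/-! Translation by `𝒪_k` moves a point `Q` along the invariant derivation `D = 2y ∂/∂x + (3x² + A)
∂/∂y` by the step `-kε`, so `h(𝒪_k + R) / h(R) = 1 - kε · (D log h)(R)`. As `D` is translation
invariant, composing with `τ` only moves the evaluation to `Q = R - T`. The product therefore
becomes a sum of logarithmic derivatives, and each is a slope plus a coboundary
(`logDeriv_line_div_vert`): `D log (ℓ/v) = m + λ(U) + λ(V) - λ(U + V)`, with `λ(U) = (y_Q + y_U) /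
(x_Q - x_U)`.

The slope is itself a symmetric 2-cocycle (`slopeOf_add_slopeOf`), hence on the multiples of `P` it
is the coboundary of `φ(n) = ∑_{k<n} m_{k,1}`. A coboundary telescopes along any decomposition of
`p` to `φ(p) - p φ(1) = φ(p)`. With `λ` replaced by `0` at `pP`, both the pairing and the slope sum
are governed by the same `φ(p)`, whatever the decompositions.

No zero or pole interferes, because `pQ = -T ≠ 0` keeps `Q` out of `E[p]`. -/

namespace EllDual

/-! ### Slopes as a 2-cocycle, via ideals of the coordinate ring -/

section Cocycle

open Polynomial WeierstrassCurve WeierstrassCurve.Affine WeierstrassCurve.Affine.CoordinateRing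

open scoped Polynomial.Bivariate

variable {K : Type*} [Field K] {A B : K}

/-- A unit of the coordinate ring of a Weierstrass curve over a field is a constant. -/
lemma exists_eq_C_of_isUnit {W : WeierstrassCurve.Affine K} {u : W.CoordinateRing}
    (hu : IsUnit u) : ∃ c : K, u = CoordinateRing.mk W (C (C c)) := by
  obtain ⟨p, q, rfl⟩ := exists_smul_basis_eq u
  have h := degree_eq_zero_of_isUnit (hu.map (Algebra.norm K[X]))
  -- The norm of `p + qY` has degree `max (2 deg p) (2 deg q + 3)`, which must be `0`.
  rw [degree_norm_smul_basis] at h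
  have hq : q = 0 := by
    by_contra hq
    have h3 : 2 • q.degree + 3 ≤ 0 := h ▸ le_max_right _ _
    rw [degree_eq_natDegree hq] at h3
    have : ((2 * q.natDegree + 3 : ℕ) : WithBot ℕ) ≤ ((0 : ℕ) : WithBot ℕ) := by
      simpa [two_mul, two_nsmul] using h3
    have := WithBot.coe_le_coe.mp this
    simp at this
  have hp : p.degree ≤ 0 := by
    by_contra! hp
    have h3 : 2 • p.degree ≤ 0 := h ▸ le_max_left _ _
    have hp0 : p ≠ 0 := by rintro rfl; simp at hp
    rw [degree_eq_natDegree hp0] at h3 hp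
    have h4 : ((2 * p.natDegree : ℕ) : WithBot ℕ) ≤ ((0 : ℕ) : WithBot ℕ) := by
      simpa [two_mul, two_nsmul] using h3
    have h4 : 2 * p.natDegree ≤ 0 := WithBot.coe_le_coe.mp h4
    have hp : 0 < p.natDegree := WithBot.coe_lt_coe.mp hp
    omega
  refine ⟨p.coeff 0, ?_⟩
  rw [← eq_C_of_degree_le_zero hp, hq, zero_smul, add_zero, CoordinateRing.smul, mul_one]

/-- The ideal of functions vanishing at a point; the unit ideal for the point at infinity. -/
noncomputable def pointIdeal : Pt A B → Ideal (shortW A B).toAffine.CoordinateRing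
  | .zero => ⊤
  | .some x y _ => XYIdeal _ x (C y)

lemma pointIdeal_neg_mul {U : Pt A B} (hU : U ≠ 0) :
    pointIdeal (-U) * pointIdeal U = XIdeal (shortW A B).toAffine (xOf U) := by
  rcases U with _ | ⟨x, y, h⟩
  · exact absurd rfl hU
  · exact XYIdeal_neg_mul h

lemma xOf_neg (U : Pt A B) : xOf (-U) = xOf U := by
  rcases U with _ | ⟨x, y, h⟩ <;> rfl

lemma yOf_neg (U : Pt A B) : yOf (-U) = -yOf U := by
  rcases U with _ | ⟨x, y, h⟩
  · exact neg_zero.symm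
  · change (shortW A B).toAffine.negY x y = -y
    simp [negY, shortW]

lemma yOf_sq {U : Pt A B} (hU : U ≠ 0) : yOf U ^ 2 = xOf U ^ 3 + A * xOf U + B := by
  rcases U with _ | ⟨x, y, h⟩
  · exact absurd rfl hU
  · have := (equation_iff _ _).mp h.1
    simpa [xOf, yOf, shortW] using this

lemma ext_xOf_yOf {U V : Pt A B} (hU : U ≠ 0) (hV : V ≠ 0) (hx : xOf U = xOf V)
    (hy : yOf U = yOf V) : U = V := by
  rcases U with _ | ⟨x, y, h⟩
  · exact absurd rfl hU
  rcases V with _ | ⟨x', y', h'⟩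
  · exact absurd rfl hV
  change x = x' at hx
  change y = y' at hy
  subst hx hy
  rfl

lemma eq_or_eq_neg_of_xOf_eq {U V : Pt A B} (hU : U ≠ 0) (hV : V ≠ 0) (hx : xOf U = xOf V) :
    U = V ∨ U = -V := by
  have h : (yOf U - yOf V) * (yOf U + yOf V) = 0 := by
    linear_combination yOf_sq hU - yOf_sq hV + (hx ▸ rfl : xOf U ^ 3 + A * xOf U =
      xOf V ^ 3 + A * xOf V)
  rcases mul_eq_zero.mp h with h | h
  · exact Or.inl (ext_xOf_yOf hU hV hx (sub_eq_zero.mp h))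
  · have hV' : -V ≠ 0 := by
      rcases V with _ | ⟨x, y, h⟩
      · exact absurd rfl hV
      · exact Point.some_ne_zero _
    refine Or.inr (ext_xOf_yOf hU hV' (hx.trans (xOf_neg V).symm) ?_)
    rw [yOf_neg]
    exact eq_neg_of_add_eq_zero_left h

lemma XIdeal_mul_injective {a : K} {I J : Ideal (shortW A B).toAffine.CoordinateRing}
    (h : XIdeal (shortW A B).toAffine a * I = XIdeal (shortW A B).toAffine a * J) : I = J :=
  (Ideal.span_singleton_mul_right_inj (XClass_ne_zero a)).mp h

variable [DecidableEq K]

/-- The polynomial `m (x - x(U)) + y(U)` of the line through `U` and `V`. -/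
noncomputable def chordPolynomial (U V : Pt A B) : K[X] :=
  linePolynomial (xOf U) (yOf U) (slopeOf U V)

lemma not_vertical {x₁ x₂ y₁ y₂ : K} {h₁ : (shortW A B).toAffine.Nonsingular x₁ y₁}
    {h₂ : (shortW A B).toAffine.Nonsingular x₂ y₂}
    (h : (Point.some x₁ y₁ h₁ : Pt A B) + Point.some x₂ y₂ h₂ ≠ 0) :
    ¬(x₁ = x₂ ∧ y₁ = (shortW A B).toAffine.negY x₂ y₂) :=
  fun hxy => h (Point.add_of_Y_eq hxy.1 hxy.2)

lemma xOf_add {U V : Pt A B} (hU : U ≠ 0) (hV : V ≠ 0) (hUV : U + V ≠ 0) :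
    xOf (U + V) = slopeOf U V ^ 2 - xOf U - xOf V := by
  rcases U with _ | ⟨x, y, h⟩
  · exact absurd rfl hU
  rcases V with _ | ⟨x', y', h'⟩
  · exact absurd rfl hV
  rw [Point.add_some (not_vertical hUV)]
  simp [xOf, slopeOf, addX, shortW]

lemma yOf_add {U V : Pt A B} (hU : U ≠ 0) (hV : V ≠ 0) (hUV : U + V ≠ 0) :
    yOf (U + V) = -(slopeOf U V * (xOf (U + V) - xOf U) + yOf U) := by
  rcases U with _ | ⟨x, y, h⟩
  · exact absurd rfl hU
  rcases V with _ | ⟨x', y', h'⟩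
  · exact absurd rfl hV
  rw [Point.add_some (not_vertical hUV)]
  simp [xOf, yOf, slopeOf, addY, negAddY, negY, addX, shortW]

lemma yOf_right {U V : Pt A B} (hU : U ≠ 0) (hV : V ≠ 0) (hUV : U + V ≠ 0) :
    yOf V = slopeOf U V * (xOf V - xOf U) + yOf U := by
  by_cases hx : xOf U = xOf V
  · rcases eq_or_eq_neg_of_xOf_eq hU hV hx with rfl | rfl
    · simp
    · simp at hUV
  · rcases U with _ | ⟨x, y, h⟩
    · exact absurd rfl hU
    rcases V with _ | ⟨x', y', h'⟩
    · exact absurd rfl hV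
    change ¬ x = x' at hx
    change y' = (shortW A B).toAffine.slope x x' y y' * (x' - x) + y
    rw [slope_of_X_ne hx]
    field_simp [sub_ne_zero.mpr hx]
    ring

/-- The restriction of the curve to the line through `U` and `V`. -/
lemma cubic_sub_chord_sq {U V : Pt A B} (hU : U ≠ 0) (hV : V ≠ 0) (hUV : U + V ≠ 0) :
    X ^ 3 + C A * X + C B - chordPolynomial U V ^ 2 =
      (X - C (xOf U)) * (X - C (xOf V)) * (X - C (xOf (U + V))) := by
  rcases U with _ | ⟨x, y, h⟩
  · exact absurd rfl hU
  rcases V with _ | ⟨x', y', h'⟩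
  · exact absurd rfl hV
  have := addPolynomial_slope h.1 h'.1 (not_vertical hUV)
  rw [Point.add_some (not_vertical hUV)]
  rw [eq_neg_iff_add_eq_zero] at this
  simp only [addPolynomial, WeierstrassCurve.Affine.polynomial, shortW, linePolynomial, C_0,
    eval_sub, eval_pow, eval_X, eval_C, zero_mul, add_zero] at this
  simp only [chordPolynomial, linePolynomial, xOf, yOf, slopeOf, shortW]
  linear_combination -this

/-- Ideal form of the divisor of `ℓ/v`, which is `(U) + (V) - (U + V) - (0)`. -/
lemma pointIdeal_mul {U V : Pt A B} (hU : U ≠ 0) (hV : V ≠ 0) (hUV : U + V ≠ 0) :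
    XIdeal (shortW A B).toAffine (xOf (U + V)) * (pointIdeal U * pointIdeal V) =
      YIdeal (shortW A B).toAffine (chordPolynomial U V) * pointIdeal (U + V) := by
  rcases U with _ | ⟨x, y, h⟩
  · exact absurd rfl hU
  rcases V with _ | ⟨x', y', h'⟩
  · exact absurd rfl hV
  rw [Point.add_some (not_vertical hUV)]
  exact XYIdeal_mul_XYIdeal h.1 h'.1 (not_vertical hUV)

/-- If three points lie on a line, the slope can be computed from any two of them. -/
lemma slopeOf_eq_of_add_eq_zero {U V W : Pt A B} (hU : U ≠ 0) (hV : V ≠ 0) (hW : W ≠ 0)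
    (h : U + V + W = 0) : slopeOf U V = slopeOf V W := by
  have h₁ : U + V = -W := eq_neg_of_add_eq_zero_left h
  have h₂ : V + W = -U := by rw [add_assoc] at h; exact eq_neg_of_add_eq_zero_right h
  -- The line generates the product of the ideals of its three points. The two lines thus differ by
  -- a constant, which is `1` by the coefficient of `Y`.
  have key : ∀ {U V W : Pt A B}, U ≠ 0 → V ≠ 0 → W ≠ 0 → U + V = -W →
      pointIdeal U * pointIdeal V * pointIdeal W = YIdeal _ (chordPolynomial U V) := by
    intro U V W hU hV hW h
    have := congrArg (· * pointIdeal W) (pointIdeal_mul hU hV (h ▸ neg_ne_zero.mpr hW))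
    rw [h, mul_assoc, mul_assoc (YIdeal _ _), pointIdeal_neg_mul hW, xOf_neg, mul_comm (YIdeal _ _)] at this
    exact XIdeal_mul_injective this
  have h₃ := key hU hV hW h₁
  have h₄ := key hV hW hU h₂
  rw [mul_comm, ← mul_assoc] at h₄
  have h₅ := h₃.symm.trans h₄
  obtain ⟨u, hu⟩ := Ideal.span_singleton_eq_span_singleton.mp h₅
  obtain ⟨c, hc⟩ := exists_eq_C_of_isUnit u.isUnit
  rw [hc] at hu
  have hu' : (C c * chordPolynomial U V - chordPolynomial V W) •
      (1 : (shortW A B).toAffine.CoordinateRing) + (1 - C c) • CoordinateRing.mk _ Y = 0 := by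
    simp only [CoordinateRing.smul, map_sub, map_mul, YClass, map_one] at hu ⊢
    linear_combination -hu
  obtain ⟨hp, hq⟩ := smul_basis_eq_zero hu'
  rw [← sub_eq_zero.mp hq, one_mul] at hp
  have := congrArg (coeff · 1) hp
  simpa [chordPolynomial, linePolynomial, sub_eq_zero, coeff_X, coeff_C] using this

/-- The slope is a symmetric two-cocycle. -/
lemma slopeOf_add_slopeOf {U V W : Pt A B} (hU : U ≠ 0) (hV : V ≠ 0) (hW : W ≠ 0)
    (hUV : U + V ≠ 0) (hVW : V + W ≠ 0) (hUVW : U + V + W ≠ 0) :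
    slopeOf U V + slopeOf (U + V) W = slopeOf V W + slopeOf U (V + W) := by
  have h₁ := pointIdeal_mul hU hV hUV
  have h₂ := pointIdeal_mul hUV hW hUVW
  have h₃ := pointIdeal_mul hV hW hVW
  have h₄ := pointIdeal_mul hU hVW (by rwa [← add_assoc])
  rw [← add_assoc] at h₄
  have h₅ := pointIdeal_neg_mul hUVW
  set E := (shortW A B).toAffine
  -- Both sides come from `(U) + (V) + (W) - (U + V + W) - 2(0)` with denominators cleared. The
  -- extra factor `x - x(U + V + W)` stands for the point ideals of `±(U + V + W)`, so that only a
  -- principal ideal has to be cancelled.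
  have h₆ : YIdeal E (chordPolynomial U V) * YIdeal E (chordPolynomial (U + V) W) *
      XIdeal E (xOf (V + W)) * XIdeal E (xOf (U + V + W)) =
      YIdeal E (chordPolynomial V W) * YIdeal E (chordPolynomial U (V + W)) *
      XIdeal E (xOf (U + V)) * XIdeal E (xOf (U + V + W)) := by
    rw [← h₅]
    calc _ = pointIdeal (-(U + V + W)) * XIdeal E (xOf (V + W)) *
          (YIdeal E (chordPolynomial U V) *
            (YIdeal E (chordPolynomial (U + V) W) * pointIdeal (U + V + W))) := by ring
      _ = pointIdeal (-(U + V + W)) * XIdeal E (xOf (V + W)) * XIdeal E (xOf (U + V + W)) *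
          (YIdeal E (chordPolynomial U V) * pointIdeal (U + V)) * pointIdeal W := by
        rw [← h₂]; ring
      _ = pointIdeal (-(U + V + W)) * XIdeal E (xOf (U + V)) * XIdeal E (xOf (U + V + W)) *
          pointIdeal U * (XIdeal E (xOf (V + W)) * (pointIdeal V * pointIdeal W)) := by
        rw [← h₁]; ring
      _ = pointIdeal (-(U + V + W)) * XIdeal E (xOf (U + V)) * YIdeal E (chordPolynomial V W) *
          (XIdeal E (xOf (U + V + W)) * (pointIdeal U * pointIdeal (V + W))) := by
        rw [h₃]; ring
      _ = _ := by rw [h₄]; ring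
  rw [mul_comm, mul_comm _ (XIdeal E (xOf (U + V + W)))] at h₆
  have h₇ := XIdeal_mul_injective h₆
  simp only [YIdeal, XIdeal, Ideal.span_singleton_mul_span_singleton] at h₇
  obtain ⟨u, hu⟩ := Ideal.span_singleton_eq_span_singleton.mp h₇
  obtain ⟨c, hc⟩ := exists_eq_C_of_isUnit u.isUnit
  rw [hc] at hu
  have hY : CoordinateRing.mk E Y ^ 2 = CoordinateRing.mk E (C (X ^ 3 + C A * X + C B)) := by
    rw [← map_pow]
    refine AdjoinRoot.mk_eq_mk.mpr ⟨1, ?_⟩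
    simp [E, WeierstrassCurve.Affine.polynomial, shortW]
  generalize hl₁ : chordPolynomial U V = l₁ at hu
  generalize hl₂ : chordPolynomial (U + V) W = l₂ at hu
  generalize hl₃ : chordPolynomial V W = l₃ at hu
  generalize hl₄ : chordPolynomial U (V + W) = l₄ at hu
  generalize xOf (V + W) = a at hu
  generalize xOf (U + V) = b at hu
  have hu' : (C c * ((X ^ 3 + C A * X + C B + l₁ * l₂) * (X - C a)) -
        (X ^ 3 + C A * X + C B + l₃ * l₄) * (X - C b)) • (1 : E.CoordinateRing) +
      ((l₃ + l₄) * (X - C b) - C c * ((l₁ + l₂) * (X - C a))) • CoordinateRing.mk E Y = 0 := by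
    rw [CoordinateRing.smul, CoordinateRing.smul]
    simp only [YClass, XClass, map_sub, map_mul, map_add] at hu hY ⊢
    linear_combination hu + (CoordinateRing.mk E (C X) - CoordinateRing.mk E (C (C b)) -
      CoordinateRing.mk E (C (C c)) *
        (CoordinateRing.mk E (C X) - CoordinateRing.mk E (C (C a)))) * hY
  obtain ⟨hp, hq⟩ := smul_basis_eq_zero hu'
  have hlin : ∀ U V : Pt A B, ∃ d : K, chordPolynomial U V = C (slopeOf U V) * X + C d :=
    fun U V => ⟨yOf U - slopeOf U V * xOf U, by
      simp only [chordPolynomial, linePolynomial, C_sub, C_mul]; ring⟩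
  obtain ⟨d₁, h₁⟩ := hlin U V
  obtain ⟨d₂, h₂⟩ := hlin (U + V) W
  obtain ⟨d₃, h₃⟩ := hlin V W
  obtain ⟨d₄, h₄⟩ := hlin U (V + W)
  rw [h₁] at hl₁; rw [h₂] at hl₂; rw [h₃] at hl₃; rw [h₄] at hl₄
  generalize slopeOf U V = m₁ at *
  generalize slopeOf (U + V) W = m₂ at *
  generalize slopeOf V W = m₃ at *
  generalize slopeOf U (V + W) = m₄ at *
  subst hl₁ hl₂ hl₃ hl₄
  have hp' : C (c - 1) * X ^ 4 + C (c * (m₁ * m₂ - a) - (m₃ * m₄ - b)) * X ^ 3 +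
      C (c * (A + m₁ * d₂ + m₂ * d₁ - a * m₁ * m₂) -
        (A + m₃ * d₄ + m₄ * d₃ - b * m₃ * m₄)) * X ^ 2 +
      C (c * (B + d₁ * d₂ - a * (A + m₁ * d₂ + m₂ * d₁)) -
        (B + d₃ * d₄ - b * (A + m₃ * d₄ + m₄ * d₃))) * X +
      C (b * (B + d₃ * d₄) - c * (a * (B + d₁ * d₂))) = 0 := by
    rw [← hp]
    simp only [map_sub, map_add, map_mul, map_one]
    ring
  have hq' : C (m₃ + m₄ - c * (m₁ + m₂)) * X ^ 2 +
      C (d₃ + d₄ - b * (m₃ + m₄) - c * (d₁ + d₂ - a * (m₁ + m₂))) * X +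
      C (c * a * (d₁ + d₂) - b * (d₃ + d₄)) = 0 := by
    rw [← hq]
    simp only [map_sub, map_add, map_mul]
    ring
  -- Leading terms in the basis `1, Y`: `X⁴` gives `c = 1`, and `X² Y` compares the sums of slopes.
  have e₁ := congrArg (coeff · 4) hp'
  have e₂ := congrArg (coeff · 2) hq'
  simp only [coeff_add, coeff_C_mul, coeff_X_pow, coeff_X, coeff_C, coeff_zero] at e₁ e₂
  norm_num at e₁ e₂
  linear_combination -e₂ - (m₁ + m₂) * e₁

end Cocycle

/-! ### Logarithmic derivatives along the invariant derivation -/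

section Derivation

open Polynomial

variable {K : Type*} [Field K] {A B : K}

/-- The slope of the line through `Q` and `-U`. -/
def negSlope (Q U : Pt A B) : K :=
  (yOf Q + yOf U) / (xOf Q - xOf U)

variable [DecidableEq K]

/-- The value at `Q` of the line through `U` and `V`. -/
def lineAt (U V Q : Pt A B) : K :=
  yOf Q - yOf U - slopeOf U V * (xOf Q - xOf U)

/-- Norm of the line function: the second factor is its conjugate under `y ↦ -y`, up to sign. -/
lemma lineAt_mul {U V Q : Pt A B} (hU : U ≠ 0) (hV : V ≠ 0) (hUV : U + V ≠ 0) (hQ : Q ≠ 0) :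
    lineAt U V Q * (2 * yOf Q - lineAt U V Q) =
      (xOf Q - xOf U) * (xOf Q - xOf V) * (xOf Q - xOf (U + V)) := by
  have h := congrArg (eval (xOf Q)) (cubic_sub_chord_sq hU hV hUV)
  simp only [chordPolynomial, WeierstrassCurve.Affine.linePolynomial, eval_sub, eval_add, eval_mul,
    eval_pow, eval_X, eval_C] at h
  rw [← h, lineAt]
  linear_combination yOf_sq hQ

lemma lineAt_ne_zero {U V Q : Pt A B} (hU : U ≠ 0) (hV : V ≠ 0) (hUV : U + V ≠ 0)
    (hQ : Q ≠ 0) (hQU : xOf Q ≠ xOf U) (hQV : xOf Q ≠ xOf V) (hQUV : xOf Q ≠ xOf (U + V)) :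
    lineAt U V Q ≠ 0 := fun h => by
  have h₀ := lineAt_mul hU hV hUV hQ
  rw [h, zero_mul] at h₀
  exact mul_ne_zero (mul_ne_zero (sub_ne_zero.mpr hQU) (sub_ne_zero.mpr hQV))
    (sub_ne_zero.mpr hQUV) h₀.symm

/-- The logarithmic derivative at `Q`, with respect to the invariant derivation, of the function
with divisor `(U) + (V) - (U + V) - (0)`. -/
lemma logDeriv_line_div_vert {U V Q : Pt A B} (hU : U ≠ 0) (hV : V ≠ 0) (hUV : U + V ≠ 0)
    (hQ : Q ≠ 0) (hQU : xOf Q ≠ xOf U) (hQV : xOf Q ≠ xOf V) (hQUV : xOf Q ≠ xOf (U + V)) :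
    (3 * xOf Q ^ 2 + A - slopeOf U V * (2 * yOf Q)) / lineAt U V Q
        - 2 * yOf Q / (xOf Q - xOf (U + V)) =
      slopeOf U V + negSlope Q U + negSlope Q V - negSlope Q (U + V) := by
  have h₀ := lineAt_mul hU hV hUV hQ
  have h₁ := congrArg (fun f => eval (xOf Q) (derivative f)) (cubic_sub_chord_sq hU hV hUV)
  simp only [chordPolynomial, WeierstrassCurve.Affine.linePolynomial, derivative_sub,
    derivative_add, derivative_mul, derivative_X, derivative_C, derivative_pow, eval_sub, eval_add, eval_mul, eval_pow, eval_X, eval_C, eval_one, eval_zero,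
    Nat.cast_ofNat] at h₁
  have hyV := yOf_right hU hV hUV
  have hyW := yOf_add hU hV hUV
  have dU := sub_ne_zero.mpr hQU
  have dV := sub_ne_zero.mpr hQV
  have dW := sub_ne_zero.mpr hQUV
  have hl := lineAt_ne_zero hU hV hUV hQ hQU hQV hQUV
  have eU : negSlope Q U = (2 * yOf Q - lineAt U V Q) / (xOf Q - xOf U) - slopeOf U V := by
    rw [negSlope, lineAt]; field_simp; ring
  have eV : negSlope Q V = (2 * yOf Q - lineAt U V Q) / (xOf Q - xOf V) - slopeOf U V := by
    rw [negSlope, lineAt, hyV]; field_simp; ring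
  have eW : negSlope Q (U + V) = lineAt U V Q / (xOf Q - xOf (U + V)) + slopeOf U V := by
    rw [negSlope, lineAt, hyW]; field_simp; ring
  rw [eU, eV, eW]
  -- Differentiating the factored cubic expresses `3x² + A` through the line and its three roots;
  -- `h₀` then closes the identity.
  have hd : 3 * xOf Q ^ 2 + A = 2 * (yOf Q - lineAt U V Q) * slopeOf U V +
      ((xOf Q - xOf U) * (xOf Q - xOf V) + (xOf Q - xOf U) * (xOf Q - xOf (U + V)) +
        (xOf Q - xOf V) * (xOf Q - xOf (U + V))) := by
    rw [lineAt]
    linear_combination h₁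
  rw [hd]
  generalize lineAt U V Q = l at *
  generalize xOf Q - xOf U = a at *
  generalize xOf Q - xOf V = b at *
  generalize xOf Q - xOf (U + V) = c at *
  field_simp
  linear_combination (-(a * b + a * c + b * c)) * h₀

end Derivation

/-! ### Translations on the canonical lift -/

section Dual

open TrivSqZeroExt

variable {K : Type*} [Field K] {A B : K}

/-- The image of `Q` under the translation by the point at infinity of parameter `k`. -/
def shiftX (k : K) (Q : Pt A B) : K[ε] :=
  inl (xOf Q) - (k * (2 * yOf Q)) • ε

/-- The `y`-coordinate of the image of `Q` under the translation by the point at infinity of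
parameter `k`. -/
def shiftY (k : K) (Q : Pt A B) : K[ε] :=
  inl (yOf Q) - (k * (3 * xOf Q ^ 2 + A)) • ε

lemma fst_two : (2 : K[ε]).fst = 2 := fst_natCast 2

lemma fst_three : (3 : K[ε]).fst = 3 := fst_natCast 3

lemma toDual_eq {Q : Pt A B} (hQ : Q ≠ 0) : toDual Q = ![inl (xOf Q), inl (yOf Q), 1] := by
  rcases Q with _ | ⟨x, y, h⟩
  · exact absurd rfl hQ
  · rfl

lemma addDual_infPt (k : K) {Q : Pt A B} (hQ : Q ≠ 0) :
    addDual A B (infPt k) (toDual Q) = ![shiftX k Q, shiftY k Q, 1] := by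
  rw [toDual_eq hQ]
  ext i
  all_goals
    fin_cases i <;>
    simp [addDual, infPt, WeierstrassCurve.Projective.addXYZ, WeierstrassCurve.Projective.addX,
      WeierstrassCurve.Projective.addY, WeierstrassCurve.Projective.negAddY,
      WeierstrassCurve.Projective.negY, WeierstrassCurve.Projective.addZ, shortW, shiftX, shiftY,
      pow_two, fst_two, fst_three]
  all_goals ring

/-- Makes evaluation at `R` the case `k = 0` of evaluation at `𝒪_k + R`. -/
lemma toDual_eq_addDual_infPt {Q : Pt A B} (hQ : Q ≠ 0) :
    toDual Q = addDual A B (infPt 0) (toDual Q) := by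
  rw [addDual_infPt 0 hQ, toDual_eq hQ]
  simp [shiftX, shiftY]

lemma yOf_eq_zero_of_two_torsion [DecidableEq K] (h2 : (2 : K) ≠ 0) {T : Pt A B}
    (hT2 : 2 • T = 0) : yOf T = 0 := by
  have h : T = -T := by rwa [two_smul, add_eq_zero_iff_eq_neg] at hT2
  have h' : yOf T = -yOf T := by
    conv_lhs => rw [h]
    exact yOf_neg T
  have : 2 * yOf T = 0 := by linear_combination h'
  exact (mul_eq_zero.mp this).resolve_left h2

/-- The chord formulas for the sum of `(X, Y)` and the point `(t, 0)` of order two, over a ring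
in which `X - t` is invertible. -/
lemma addXYZ_two_torsion {S : Type*} [CommRing S] {a b X Y t D : S}
    (hXY : Y ^ 2 = X ^ 3 + a * X + b) (ht : t ^ 3 + a * t + b = 0) (hD : (X - t) * D = 1) :
    (shortW a b).toProjective.addXYZ ![X, Y, 1] ![t, 0, 1] =
      ![((Y * D) ^ 2 - X - t) * (X - t) ^ 3,
        -(Y * D * ((Y * D) ^ 2 - X - t - X) + Y) * (X - t) ^ 3, (X - t) ^ 3] := by
  have h₂ : D ^ 2 * (X - t) ^ 3 = X - t := by
    linear_combination (X - t) * ((X - t) * D + 1) * hD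
  have h₃ : D * (X - t) ^ 3 = (X - t) ^ 2 := by linear_combination (X - t) ^ 2 * hD
  have h₄ : D ^ 3 * (X - t) ^ 3 = 1 := by
    linear_combination (((X - t) * D) ^ 2 + (X - t) * D + 1) * hD
  rw [WeierstrassCurve.Projective.addXYZ]
  congr 1
  · simp [WeierstrassCurve.Projective.addX, shortW]
    linear_combination (2 * t - X) * hXY + (2 * X - t) * ht - Y ^ 2 * h₂
  congr 1
  · simp [WeierstrassCurve.Projective.addY, WeierstrassCurve.Projective.negAddY,
      WeierstrassCurve.Projective.negY, shortW]
    linear_combination Y * hXY - 2 * Y * ht + Y ^ 3 * h₄ - Y * (2 * X + t) * h₃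
  · simp [WeierstrassCurve.Projective.addZ, shortW]
    linear_combination hXY + ht

/-- Invariance of the derivation: translating by `-T` commutes with the infinitesimal shift. Since
`T = -T`, the chord through `R` and `T` computes `R - T`. -/
lemma transl_addDual_infPt [DecidableEq K] (h2 : (2 : K) ≠ 0) (k : K) {T R : Pt A B} (hT : T ≠ 0)
    (hT2 : 2 • T = 0) (hR : R ≠ 0) (hRT : R ≠ T) :
    IsUnit (transl T (addDual A B (infPt k) (toDual R)) 2) ∧
      xDual (transl T (addDual A B (infPt k) (toDual R))) = shiftX k (R - T) ∧
      yDual (transl T (addDual A B (infPt k) (toDual R))) = shiftY k (R - T) := by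
  have hnT : -T = T := by rw [two_smul, add_eq_zero_iff_eq_neg] at hT2; exact hT2.symm
  have hyT := yOf_eq_zero_of_two_torsion h2 hT2
  have hx : xOf R ≠ xOf T := fun h => by
    rcases eq_or_eq_neg_of_xOf_eq hR hT h with h | h
    · exact hRT h
    · exact hRT (h.trans hnT)
  have hRT0 : R + T ≠ 0 := fun h => hRT ((eq_neg_of_add_eq_zero_left h).trans hnT)
  have hd := sub_ne_zero.mpr hx
  have hm : slopeOf R T = yOf R / (xOf R - xOf T) := by
    rw [eq_div_iff hd]
    linear_combination yOf_right hR hT hRT0 - hyT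
  have hxQ := xOf_add hR hT hRT0
  have hyQ := yOf_add hR hT hRT0
  rw [hm] at hxQ hyQ
  have hsR := yOf_sq hR
  have hsT := yOf_sq hT
  rw [hyT] at hsT
  have hs : yOf R ^ 2 = (xOf R - xOf T) * (xOf R ^ 2 + xOf R * xOf T + xOf T ^ 2 + A) := by
    linear_combination hsR - hsT
  have hu : (shiftX k R - inl (xOf T)).fst ≠ 0 := by simpa [shiftX] using hd
  have hXY : shiftY k R ^ 2 = shiftX k R ^ 3 + inl A * shiftX k R + inl B := by
    ext
    · simpa [shiftX, shiftY] using hsR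
    · simp [shiftX, shiftY, pow_succ]
      ring
  have ht : (inl (xOf T) : K[ε]) ^ 3 + inl A * inl (xOf T) + inl B = 0 := by
    ext
    · simpa using hsT.symm
    · simp [pow_succ]
  have key := addXYZ_two_torsion hXY ht (TrivSqZeroExt.mul_inv_cancel hu)
  have htr : transl T (addDual A B (infPt k) (toDual R)) =
      (shortW (inl A : K[ε]) (inl B)).toProjective.addXYZ ![shiftX k R, shiftY k R, 1]
        ![inl (xOf T), 0, 1] := by
    rw [addDual_infPt k hR, transl, hnT, toDual_eq hT, hyT, addDual, inl_zero]
  rw [htr, key, sub_eq_add_neg R T, hnT]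
  have hu3 : ((shiftX k R - inl (xOf T)) ^ 3).fst ≠ 0 := by
    rw [fst_pow]
    exact pow_ne_zero 3 hu
  have hxeq : (shiftY k R * (shiftX k R - inl (xOf T))⁻¹) ^ 2 - shiftX k R - inl (xOf T) =
      shiftX k (R + T) := by
    ext
    · simp [shiftX, shiftY, hxQ, div_eq_mul_inv]
    · simp [shiftX, shiftY, hyQ, hxQ, pow_two]
      field_simp
      linear_combination 2 * k * yOf R * (hsR - hsT)
  refine ⟨isUnit_iff_isUnit_fst.mpr hu3.isUnit, ?_, ?_⟩
  · simp only [xDual, Matrix.cons_val]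
    rw [mul_assoc, TrivSqZeroExt.mul_inv_cancel hu3, mul_one, hxeq]
  · simp only [yDual, Matrix.cons_val]
    rw [mul_assoc, TrivSqZeroExt.mul_inv_cancel hu3, mul_one, hxeq]
    ext
    · simp [shiftX, shiftY, hyQ, div_eq_mul_inv]
    · simp [shiftX, shiftY, hyQ, hxQ]
      field_simp
      rw [hs]
      ring

end Dual

/-! ### Telescoping along decompositions -/

section Chains

lemma Decomposes.mem {S : Finset ℕ} {M : Multiset ℕ} {C : List (ℕ × ℕ)} (h : Decomposes S M C)
    {s : ℕ × ℕ} (hs : s ∈ C) : s.1 ∈ S ∧ s.2 ∈ S ∧ s.1 + s.2 ∈ S := by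
  induction h with
  | nil n => simp at hs
  | cons i j M C hi hj hij _ ih =>
    rcases List.mem_cons.mp hs with rfl | hs
    · exact ⟨hi, hj, hij⟩
    · exact ih hs

/-- Each step trades `φ (i + j)` for `φ i + φ j`; the ones left at the end number `M.sum`. -/
lemma Decomposes.sum_map {K : Type*} [CommRing K] {S : Finset ℕ} {M : Multiset ℕ}
    {C : List (ℕ × ℕ)} (h : Decomposes S M C) (F : ℕ × ℕ → K) (φ : ℕ → K)
    (hF : ∀ i ∈ S, ∀ j ∈ S, i + j ∈ S → F (i, j) = φ (i + j) - φ i - φ j) :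
    (C.map F).sum = (M.map φ).sum - M.sum * φ 1 := by
  induction h with
  | nil n => simp
  | cons i j M C hi hj hij _ ih =>
    simp only [Multiset.map_cons, Multiset.sum_cons, Nat.cast_add, List.map_cons,
      List.sum_cons] at ih ⊢
    rw [ih, hF i hi j hj hij]
    ring

/-- In characteristic `p`, the sum of a coboundary over an addition chain decomposition of `p`
does not depend on the decomposition. -/
lemma IsChainDecomposition.sum_map {K : Type*} [CommRing K] {p : ℕ} [CharP K p] {S : Finset ℕ}
    {C : List (ℕ × ℕ)} (h : IsChainDecomposition S p C) (F : ℕ × ℕ → K) (φ : ℕ → K)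
    (hF : ∀ i j, 1 ≤ i → 1 ≤ j → i + j ≤ p → F (i, j) = φ (i + j) - φ i - φ j) :
    (C.map F).sum = φ p := by
  rw [h.2.sum_map F φ fun i hi j hj hij => hF i j (Finset.mem_Icc.mp (h.1.1 hi)).1
    (Finset.mem_Icc.mp (h.1.1 hj)).1 (Finset.mem_Icc.mp (h.1.1 hij)).2]
  simp

end Chains

/-! ### Slopes at multiples of `P` as a coboundary -/

section Torsion

variable {K : Type*} [Field K] [DecidableEq K] {A B : K} {p : ℕ} [Fact p.Prime] {P : Pt A B}

lemma nsmul_ne_zero_of_lt (hP : p • P = 0) (hP0 : P ≠ 0) {n : ℕ} (h1 : 1 ≤ n) (hn : n < p) :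
    n • P ≠ 0 := fun h => by
  have := addOrderOf_dvd_of_nsmul_eq_zero h
  rw [addOrderOf_eq_prime hP hP0] at this
  exact absurd (Nat.le_of_dvd h1 this) (not_le.mpr hn)

lemma slopeOf_of_add_eq_zero {U V : Pt A B} (h : U + V = 0) : slopeOf U V = 0 := by
  rcases U with _ | ⟨x, y, hU⟩
  · rfl
  rcases V with _ | ⟨x', y', hV⟩
  · rfl
  have h' : x = x' ∧ y = (shortW A B).toAffine.negY x' y' := by
    by_contra hc
    rw [WeierstrassCurve.Affine.Point.add_some hc] at h
    exact WeierstrassCurve.Affine.Point.some_ne_zero _ h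
  exact WeierstrassCurve.Affine.slope_of_Y_eq h'.1 h'.2

/-- The slopes of the lines through the multiples of a point of order `p` are the coboundary of
the partial sums `∑ m_{k,1}`. -/
lemma slopeOf_nsmul_nsmul (hP : p • P = 0) (hP0 : P ≠ 0) {i j : ℕ} (hi : 1 ≤ i) (hj : 1 ≤ j)
    (hij : i + j ≤ p) :
    slopeOf (i • P) (j • P) = ∑ k ∈ Finset.range (i + j), slopeOf (k • P) P -
      ∑ k ∈ Finset.range i, slopeOf (k • P) P - ∑ k ∈ Finset.range j, slopeOf (k • P) P := by
  -- The term `k = 0` of the partial sums is the default value `0`.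
  have h0 : slopeOf (0 : Pt A B) P = 0 := by rcases P with _ | _ <;> rfl
  induction j, hj using Nat.le_induction with
  | base => simp [Finset.sum_range_succ, h0]
  | succ j hj ih =>
    have ih := ih (by omega)
    have hi' := nsmul_ne_zero_of_lt hP hP0 hi (by omega)
    have hj' := nsmul_ne_zero_of_lt hP hP0 hj (by omega)
    have hij' : i • P + j • P ≠ 0 := by
      rw [← add_smul]
      exact nsmul_ne_zero_of_lt hP hP0 (by omega) (by omega)
    have hj1 : j • P + P ≠ 0 := by
      rw [← succ_nsmul]
      exact nsmul_ne_zero_of_lt hP hP0 (by omega) (by omega)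
    have key : slopeOf (i • P) (j • P) + slopeOf ((i + j) • P) P =
        slopeOf (j • P) P + slopeOf (i • P) ((j + 1) • P) := by
      rw [add_smul i j, succ_nsmul]
      -- At `i + j + 1 = p` the cocycle relation degenerates: the vertical slopes are `0` and the
      -- three points are collinear.
      by_cases h : i • P + j • P + P = 0
      · rw [slopeOf_of_add_eq_zero h, slopeOf_of_add_eq_zero ((add_assoc _ _ _).symm.trans h),
          add_zero, add_zero]
        exact slopeOf_eq_of_add_eq_zero hi' hj' hP0 h
      · exact slopeOf_add_slopeOf hi' hj' hP0 hij' hj1 h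
    rw [← add_assoc, Finset.sum_range_succ, Finset.sum_range_succ _ j]
    linear_combination ih - key

end Torsion

/-! ### Evaluation of a single step -/

section Evaluation

open TrivSqZeroExt

variable {K : Type*} [Field K] {A B : K}

lemma mul_inv_eq_one_sub {a b : K[ε]} {d : K} (hb : b.fst ≠ 0) (hb' : b.snd = 0)
    (ha : a.fst = b.fst) (ha' : a.snd = -(d * b.fst)) : a * b⁻¹ = 1 - d • ε := by
  ext
  · simp [ha, hb]
  · simp [ha', hb', hb]

lemma prod_map_one_sub {ι : Type*} (C : List ι) (k : K) (d : ι → K) :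
    (C.map fun s => (1 - (k * d s) • ε : K[ε])).prod = 1 - ((C.map d).sum * k) • ε := by
  induction C with
  | nil => simp
  | cons s C ih =>
    rw [List.map_cons, List.prod_cons, ih, List.map_cons, List.sum_cons]
    ext
    · simp
    · simp
      ring

variable [DecidableEq K]

/-- The logarithmic derivative at `Q` of the function `g_{i,j}` with `h_{i,j} = g_{i,j} ∘ τ`. -/
def logDerivStep (p : ℕ) (P Q : Pt A B) (s : ℕ × ℕ) : K :=
  if s.1 + s.2 = p then 2 * yOf Q / (xOf Q - xOf (s.1 • P))
  else (3 * xOf Q ^ 2 + A - slopeOf (s.1 • P) (s.2 • P) * (2 * yOf Q)) /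
    lineAt (s.1 • P) (s.2 • P) Q - 2 * yOf Q / (xOf Q - xOf ((s.1 + s.2) • P))

variable {p : ℕ} [Fact p.Prime] {P Q : Pt A B}

/-- The vertical step fits the same formula: `2y_Q / (x_Q - x_U) = λ(U) + λ(-U)`, its slope is `0`,
and the term at infinity is set to `0`. -/
lemma logDerivStep_eq (hP : p • P = 0) (hP0 : P ≠ 0) (hQ : Q ≠ 0)
    (hx : ∀ n, 1 ≤ n → n < p → xOf Q ≠ xOf (n • P)) {i j : ℕ} (hi : 1 ≤ i) (hj : 1 ≤ j)
    (hij : i + j ≤ p) :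
    logDerivStep p P Q (i, j) = slopeOf (i • P) (j • P) + negSlope Q (i • P) + negSlope Q (j • P)
      - if i + j = p then 0 else negSlope Q ((i + j) • P) := by
  have hsum : i • P + j • P = (i + j) • P := (add_smul i j P).symm
  by_cases h : i + j = p
  · rw [logDerivStep, if_pos h, if_pos h]
    rw [h, hP] at hsum
    have hjP : j • P = -(i • P) := eq_neg_of_add_eq_zero_right hsum
    rw [slopeOf_of_add_eq_zero hsum, hjP, negSlope, negSlope, xOf_neg, yOf_neg]
    ring
  · rw [logDerivStep, if_neg h, if_neg h, ← hsum]
    refine logDeriv_line_div_vert (nsmul_ne_zero_of_lt hP hP0 hi (by omega))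
      (nsmul_ne_zero_of_lt hP hP0 hj (by omega)) ?_ hQ (hx i hi (by omega)) (hx j hj (by omega)) ?_
    · exact hsum ▸ nsmul_ne_zero_of_lt hP hP0 (by omega) (by omega)
    · exact hsum ▸ hx _ (by omega) (by omega)

lemma hEval_step (h2 : (2 : K) ≠ 0) {T R : Pt A B} (hT : T ≠ 0) (hT2 : 2 • T = 0) (hR : R ≠ 0)
    (hRT : R ≠ T) (hP : p • P = 0) (hP0 : P ≠ 0)
    (hx : ∀ n, 1 ≤ n → n < p → xOf (R - T) ≠ xOf (n • P)) (k : K) {i j : ℕ} (hi : 1 ≤ i)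
    (hj : 1 ≤ j) (hij : i + j ≤ p) :
    hDefined p T P (i, j) (addDual A B (infPt k) (toDual R)) ∧
      IsUnit (hEval p T P (i, j) (toDual R)) ∧
      hEval p T P (i, j) (addDual A B (infPt k) (toDual R)) *
        (hEval p T P (i, j) (toDual R))⁻¹ = 1 - (k * logDerivStep p P (R - T) (i, j)) • ε := by
  obtain ⟨hZ, hX, hY⟩ := transl_addDual_infPt h2 k hT hT2 hR hRT
  obtain ⟨-, hX0, hY0⟩ := transl_addDual_infPt h2 0 hT hT2 hR hRT
  rw [← toDual_eq_addDual_infPt hR] at hX0 hY0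
  have hQ : R - T ≠ 0 := sub_ne_zero.mpr hRT
  generalize R - T = Q at *
  have hxi := sub_ne_zero.mpr (hx i hi (by omega))
  by_cases h : i + j = p
  · have hb : (hEval p T P (i, j) (toDual R)).fst = xOf Q - xOf (i • P) := by
      simp [hEval, h, vertEval, hX0, shiftX]
    have hb0 : (hEval p T P (i, j) (toDual R)).fst ≠ 0 := hb ▸ hxi
    refine ⟨⟨hZ, fun h' => absurd h h'⟩, isUnit_iff_isUnit_fst.mpr hb0.isUnit,
      mul_inv_eq_one_sub hb0 ?_ ?_ ?_⟩
    · simp [hEval, h, vertEval, hX0, shiftX]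
    · rw [hb]
      simp [hEval, h, vertEval, hX, shiftX]
    · rw [hb]
      simp [hEval, h, vertEval, hX, shiftX, logDerivStep]
      field_simp
  · have hsum : i • P + j • P = (i + j) • P := (add_smul i j P).symm
    have hxij := sub_ne_zero.mpr (hx (i + j) (by omega) (by omega))
    have hl : lineAt (i • P) (j • P) Q ≠ 0 :=
      lineAt_ne_zero (nsmul_ne_zero_of_lt hP hP0 hi (by omega))
        (nsmul_ne_zero_of_lt hP hP0 hj (by omega))
        (hsum ▸ nsmul_ne_zero_of_lt hP hP0 (by omega) (by omega)) hQ (hx i hi (by omega))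
        (hx j hj (by omega)) (hsum ▸ hx _ (by omega) (by omega))
    have hb : (hEval p T P (i, j) (toDual R)).fst =
        lineAt (i • P) (j • P) Q / (xOf Q - xOf ((i + j) • P)) := by
      simp [hEval, h, vertEval, lineEval, hX0, hY0, shiftX, shiftY, lineAt, div_eq_mul_inv]
    have hb0 : (hEval p T P (i, j) (toDual R)).fst ≠ 0 := hb ▸ div_ne_zero hl hxij
    refine ⟨⟨hZ, fun _ => isUnit_iff_isUnit_fst.mpr (IsUnit.mk0 _ ?_)⟩,
      isUnit_iff_isUnit_fst.mpr hb0.isUnit, mul_inv_eq_one_sub hb0 ?_ ?_ ?_⟩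
    · simpa [vertEval, hX, shiftX] using hxij
    · simp [hEval, h, vertEval, lineEval, hX0, hY0, shiftX, shiftY]
    · rw [hb]
      simp [hEval, h, vertEval, lineEval, hX, hY, shiftX, shiftY, lineAt, div_eq_mul_inv]
    · rw [hb]
      have e : yOf Q - yOf (i • P) - slopeOf (i • P) (j • P) * (xOf Q - xOf (i • P)) =
        lineAt (i • P) (j • P) Q := rfl
      simp [hEval, h, vertEval, lineEval, hX, hY, shiftX, shiftY, logDerivStep, e]
      field_simp
      ring

end Evaluation

end EllDual

/-! ### The main theorem -/

theorem mainTheorem3 {K : Type*} [Field K] [IsAlgClosed K] [DecidableEq K]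
    (p : ℕ) [Fact p.Prime] [CharP K p] (hp2 : p ≠ 2) (hp3 : p ≠ 3)
    (A B : K) (hE : 4 * A ^ 3 + 27 * B ^ 2 ≠ 0)
    (T R : Pt A B) (hT : T ≠ 0) (hT2 : 2 • T = 0) (hR : p • R = 0) (hR2 : 2 • R ≠ 0)
    (S₀ : Finset ℕ) (C₀ : List (ℕ × ℕ)) (hC₀ : IsChainDecomposition S₀ p C₀)
    (P : Pt A B) (hP : p • P = 0) (k : K)
    (S : Finset ℕ) (C : List (ℕ × ℕ)) (hC : IsChainDecomposition S p C) :
    (P ≠ 0 → ∀ s ∈ C₀, hDefined p T P s (toDual R) ∧ IsUnit (hEval p T P s (toDual R)) ∧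
      hDefined p T P s (addDual A B (infPt k) (toDual R))) ∧
    pairing p T R C₀ P (infPt k) =
      1 - ((C.map fun s => slopeOf (s.1 • P) (s.2 • P)).sum * k) • (ε : K[ε]) := by
  have hp := Fact.out (p := p.Prime)
  have h2 : (2 : K) ≠ 0 := by
    have := mt (CharP.cast_eq_zero_iff K p 2).mp
      fun h => hp2 ((Nat.prime_dvd_prime_iff_eq hp Nat.prime_two).mp h)
    exact_mod_cast this
  have hR0 : R ≠ 0 := by
    rintro rfl
    simp at hR2
  have hRT : R ≠ T := by
    rintro rfl
    exact hR2 hT2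
  have hpT : p • T = T := by
    obtain ⟨m, hm⟩ := hp.odd_of_ne_two hp2
    rw [hm, add_smul, mul_comm, mul_smul, hT2, smul_zero, zero_add, one_smul]
  have hQ : R - T ≠ 0 := sub_ne_zero.mpr hRT
  have hpQ : p • (R - T) ≠ 0 := by
    rw [smul_sub, hR, hpT, zero_sub]
    exact neg_ne_zero.mpr hT
  have hx : P ≠ 0 → ∀ n, 1 ≤ n → n < p → xOf (R - T) ≠ xOf (n • P) := by
    intro hP0 n h1 hn h
    have hnP : p • n • P = 0 := by rw [smul_comm, hP, smul_zero]
    rcases eq_or_eq_neg_of_xOf_eq hQ (nsmul_ne_zero_of_lt hP hP0 h1 hn) h with h | h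
    · exact hpQ (h ▸ hnP)
    · exact hpQ (by rw [h, smul_neg, hnP, neg_zero])
  have hbd : ∀ s ∈ C₀, 1 ≤ s.1 ∧ 1 ≤ s.2 ∧ s.1 + s.2 ≤ p := fun s hs =>
    have h := hC₀.2.mem hs
    ⟨(Finset.mem_Icc.mp (hC₀.1.1 h.1)).1, (Finset.mem_Icc.mp (hC₀.1.1 h.2.1)).1,
      (Finset.mem_Icc.mp (hC₀.1.1 h.2.2)).2⟩
  have hstep := fun (hP0 : P ≠ 0) (k : K) (s : ℕ × ℕ) (hs : s ∈ C₀) =>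
    hEval_step h2 hT hT2 hR0 hRT hP hP0 (hx hP0) k (hbd s hs).1 (hbd s hs).2.1 (hbd s hs).2.2
  refine ⟨fun hP0 s hs => ⟨?_, (hstep hP0 k s hs).2.1, (hstep hP0 k s hs).1⟩, ?_⟩
  · rw [toDual_eq_addDual_infPt hR0]
    exact (hstep hP0 0 s hs).1
  by_cases hP0 : P = 0
  · have : ∀ U : Pt A B, slopeOf (0 : Pt A B) U = 0 := fun U => by rcases U with _ | _ <;> rfl
    simp [pairing, hP0, this]
  by_cases hk : k = 0
  · simp [pairing, hk]
  have hinf : infPt k ≠ infPt 0 := fun h => hk (by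
    simpa [infPt] using congrArg TrivSqZeroExt.snd (congrFun h 0))
  rw [pairing, if_neg (not_or.mpr ⟨hP0, hinf⟩),
    List.map_congr_left fun s hs => (hstep hP0 k s hs).2.2, prod_map_one_sub]
  rw [hC.sum_map _ (fun n => ∑ k ∈ Finset.range n, slopeOf (k • P) P)
      fun i j hi hj hij => slopeOf_nsmul_nsmul hP hP0 hi hj hij,
    -- The `λ` correction is switched off at `n = p`, so this potential and the one for `C` agree
    -- there.
    hC₀.sum_map _ (fun n => ∑ k ∈ Finset.range n, slopeOf (k • P) P -
      if n = p then 0 else negSlope (R - T) (n • P)) fun i j hi hj hij => ?_]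
  · simp
  · rw [show (logDerivStep p P (R - T) (i, j)) = _ from
      logDerivStep_eq hP hP0 hQ (hx hP0) hi hj hij, slopeOf_nsmul_nsmul hP hP0 hi hj hij,
      if_neg (show i ≠ p by omega), if_neg (show j ≠ p by omega)]
    ring
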